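/- For a partition $\lambda_1\ge\lambda_2\ge\cdots\ge\lambda_r>0$ of $n$, set $\lambda_j=0$ for $j>r$, and define its alternating sum type (modulo $3$) to be the pair $(\Sigma_1,\Sigma_2)$ with $$\Sigma_1=\sum_{k\ge 0}(\lambda_{3k+1}-\lambda_{3k+2}),\qquad \Sigma_2=\sum_{k\ge 0}(\lambda_{3k+2}-\lambda_{3k+3}).$$ **Theorem 3.1.** Let $n\ge 0$ and $\Sigma\ge 0$ be integers. The number of partitions of $n$ in which each part is repeated at most twice and whose alternating sum type is $(\Sigma,2)$ equals the number of partitions of $n$ with no part divisible by $3$, with exactly $\Sigma$ parts $\equiv 1\pmod 3$ and exactly $2$ parts $\equiv 2\pmod 3$. Likewise, the number of partitions of $n$ in which each part is repeated at most twice and whose alternating sum type is $(2,\Sigma)$ equals the number of partitions of $n$ with no part divisible by $3$, with exactly $2$ parts $\equiv 1\pmod 3$ and exactly $\Sigma$ parts $\equiv 2\pmod 3$. -/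

import Mathlib

namespace PartitionType

/-- The partition written as `λ₁ ≥ λ₂ ≥ …`, prolonged by zeros: `part p j` is `λ_{j+1}`,
and it is `0` when `j` is at least the number of parts of `p`. -/
def part {n : ℕ} (p : n.Partition) (j : ℕ) : ℕ :=
  (p.parts.sort (fun a b => b ≤ a)).getD j 0

/-- The parts are listed in weakly decreasing order, so that the natural-number subtractions in
`altSum` never truncate. -/
theorem part_antitone {n : ℕ} (p : n.Partition) : Antitone (part p) := by
  intro i j hij
  unfold part
  have h := Multiset.pairwise_sort p.parts (fun a b : ℕ => b ≤ a)
  by_cases hj : j < (p.parts.sort (fun a b => b ≤ a)).length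
  · have hi := lt_of_le_of_lt hij hj
    rw [List.getD_eq_getElem _ _ hj, List.getD_eq_getElem _ _ hi]
    rcases hij.eq_or_lt with e | e
    · subst e; exact le_rfl
    · exact List.pairwise_iff_getElem.mp h i j hi hj e
  · rw [List.getD_eq_default _ _ (not_lt.mp hj)]
    exact Nat.zero_le _

/-- The component `Σ_i` (`1 ≤ i ≤ m - 1`) of the alternating sum type of `p` modulo `m`:
cut `λ₁ ≥ λ₂ ≥ …` into blocks of length `m` and sum `λ_{km+i} - λ_{km+i+1}` over the blocks
`k = 0, 1, …`. All blocks with `k` at least the number of parts consist of padding zeros. -/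
def altSum (m : ℕ) {n : ℕ} (p : n.Partition) (i : ℕ) : ℕ :=
  ∑ k ∈ Finset.range p.parts.card, (part p (k * m + i - 1) - part p (k * m + i))

/-- The component `l_i` (`1 ≤ i ≤ m - 1`) of the length type of `p` modulo `m`:
the number of parts, with multiplicity, congruent to `i` modulo `m`. -/
def lengthType (m : ℕ) {n : ℕ} (p : n.Partition) (i : ℕ) : ℕ :=
  p.parts.countP (fun a => a ≡ i [MOD m])

/-- The number of partitions of `n` in which each part occurs at most `2` times and whose
alternating sum type modulo `3` is `(s, t)`. -/
def numAltSumType (s t n : ℕ) : ℕ :=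
  ((Nat.Partition.countRestricted n 3).filter fun p => altSum 3 p 1 = s ∧ altSum 3 p 2 = t).card

/-- The number of partitions of `n` with no part divisible by `3` and with exactly `s` parts
congruent to `1` and exactly `t` parts congruent to `2` modulo `3`. -/
def numLengthType (s t n : ℕ) : ℕ :=
  ((Nat.Partition.restricted n (¬ 3 ∣ ·)).filter fun p => lengthType 3 p 1 = s ∧ lengthType 3 p 2 = t).card

end PartitionType

namespace PartitionType

/-! The equality holds for every type `(s, t)`; the entry 2 plays no role. Conjugation turns the
sequence λ into a partition having `λ_i - λ_{i+1}` parts equal to `i`. So Σ₁ and Σ₂ count its parts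
≡ 1 and ≡ 2 mod 3, and "no part more than twice" says that consecutive parts, the last one and 0
included, differ by at most 2 (a flat partition).

Both families are coded by a word `w` of residues 1, 2, read from the smallest part up, with one
natural number per letter. Without multiples of 3, the quotient by 3 must rise by one at each
descent 2, 1 of `w`, and the number is the additional rise, the gap. In a flat partition, the
multiples of 3 between two consecutive letters are copies of a single one, and the number is their
multiplicity; the quotient rises by one exactly after a descent or after such multiples.

For fixed `w`, `toGaps` is a bijection from multiplicities to gaps that preserves size
(`gapSize_toGaps`). The codings are `exists_flatSeq_eq`, `flatSeq_injective`, `exists_gapParts_eq`,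
`gapParts_injective`; `blockSum_flatSeq`, `countP_gapParts` and `sum_gapParts` read type and size
off the code. -/

/-- The value of a letter: `false` stands for a part `≡ 1` and `true` for a part `≡ 2` mod `3`. -/
def letter (b : Bool) : ℕ := if b then 2 else 1

/-- Whether the letter `b` is followed in the word `b :: w` by a descent or by nothing at all. -/
def brk : Bool → List Bool → Bool
  | _, [] => true
  | true, false :: _ => true
  | _, _ => false

/-- The size (up to the factor `3`) of the partition with word `w` and gaps `gs`, in which no part
is divisible by `3`. -/
def gapSize : List Bool → List ℕ → ℕ
  | b :: w, g :: gs =>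
    g * (w.length + 1) + (if brk b w then w.length else 0) + gapSize w gs
  | _, _ => 0

/-- The size (up to the factor `3`) of the flat partition with word `w` in which the letters are
separated by `ms` multiples of `3`. -/
def flatSize : List Bool → List ℕ → ℕ
  | b :: w, m :: ms =>
    (if brk b w ∨ m ≠ 0 then m + ms.sum + w.length else 0) + flatSize w ms
  | _, _ => 0

/-- Add one to the first entry of a list. -/
def incHead : List ℕ → List ℕ
  | [] => []
  | a :: l => (a + 1) :: l

/-- The map from multiplicities of multiples of `3` to gaps, for a fixed word. -/
def toGaps : List Bool → List ℕ → List ℕ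
  | b :: w, m :: ms =>
    if brk b w then toGaps w ms ++ [m]
    else match m with
      | 0 => 0 :: toGaps w ms
      | m + 1 => incHead (toGaps w ms ++ [m])
  | _, _ => []

/-! ### The bijection from multiplicities to gaps -/

theorem toGaps_cons (b : Bool) (w : List Bool) (m : ℕ) (ms : List ℕ) :
    toGaps (b :: w) (m :: ms) =
      if brk b w then toGaps w ms ++ [m]
      else match m with
        | 0 => 0 :: toGaps w ms
        | m + 1 => incHead (toGaps w ms ++ [m]) := rfl

theorem length_incHead (l : List ℕ) : (incHead l).length = l.length := by
  cases l <;> simp [incHead]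

theorem incHead_injective : Function.Injective incHead := by
  intro l l' h
  cases l <;> cases l' <;> simp_all [incHead]

theorem incHead_ne_zero_cons (l l' : List ℕ) : incHead l ≠ 0 :: l' := by
  cases l <;> simp [incHead]

theorem length_toGaps {w : List Bool} {ms : List ℕ} (h : ms.length = w.length) :
    (toGaps w ms).length = w.length := by
  induction w generalizing ms with
  | nil => simp [toGaps]
  | cons b w ih =>
    match ms, h with
    | m :: ms, h =>
      have := ih (ms := ms) (by simpa using h)
      rw [toGaps_cons]
      split_ifs
      · simp [this]
      · cases m <;> simp [length_incHead, this]

theorem sum_toGaps {w : List Bool} {ms : List ℕ} (h : ms.length = w.length) :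
    (toGaps w ms).sum = ms.sum := by
  induction w generalizing ms with
  | nil =>
    have : ms = [] := by simpa using h
    simp [toGaps, this]
  | cons b w ih =>
    match ms, h with
    | m :: ms, h =>
      have := ih (ms := ms) (by simpa using h)
      rw [toGaps_cons]
      split_ifs
      · simp [this, add_comm]
      · cases m with
        | zero => simp [this]
        | succ m =>
          cases hl : toGaps w ms with
          | nil => simp_all [incHead]
          | cons a l => simp_all [incHead]; omega

/-- The word fixes whether the first letter is a break; if it is not, a zero or nonzero head tells
which branch was used. The last entry then gives back the multiplicity. -/
theorem toGaps_injOn {w : List Bool} {ms ms' : List ℕ} (h : ms.length = w.length)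
    (h' : ms'.length = w.length) (e : toGaps w ms = toGaps w ms') : ms = ms' := by
  induction w generalizing ms ms' with
  | nil => simp_all
  | cons b w ih =>
    match ms, h, ms', h' with
    | m :: ms, h, m' :: ms', h' =>
      have hl := Nat.succ_injective h
      have hl' := Nat.succ_injective h'
      rw [toGaps_cons, toGaps_cons] at e
      split_ifs at e
      · obtain ⟨e, e'⟩ := List.append_inj' e rfl
        rw [ih hl hl' e, List.singleton_injective e']
      · cases m <;> cases m' <;> simp only at e
        · rw [ih hl hl' (List.cons_injective e)]
        · exact (incHead_ne_zero_cons _ _ e.symm).elim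
        · exact (incHead_ne_zero_cons _ _ e).elim
        · obtain ⟨e, e'⟩ := List.append_inj' (incHead_injective e) rfl
          rw [ih hl hl' e, List.singleton_injective e']

theorem exists_toGaps_eq {w : List Bool} {gs : List ℕ} (h : gs.length = w.length) :
    ∃ ms : List ℕ, ms.length = w.length ∧ toGaps w ms = gs := by
  induction w generalizing gs with
  | nil => exact ⟨[], rfl, by simp_all [toGaps]⟩
  | cons b w ih =>
    have key : ∀ l : List ℕ, l.length = w.length + 1 →
        ∃ (m : ℕ) (ms : List ℕ), ms.length = w.length ∧ toGaps w ms ++ [m] = l := by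
      intro l hl
      have hne : l ≠ [] := by rintro rfl; simp at hl
      obtain ⟨ms, h1, h2⟩ := ih (gs := l.dropLast) (by simp [hl])
      exact ⟨l.getLast hne, ms, h1, by rw [h2, List.dropLast_append_getLast]⟩
    by_cases hb : brk b w = true
    · obtain ⟨m, ms, h1, h2⟩ := key gs h
      exact ⟨m :: ms, by simp [h1], by simp [toGaps, hb, h2]⟩
    · match gs, h with
      | 0 :: gs, h =>
        obtain ⟨ms, h1, h2⟩ := ih (gs := gs) (by simpa using h)
        exact ⟨0 :: ms, by simp [h1], by simp [toGaps, hb, h2]⟩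
      | (g + 1) :: gs, h =>
        obtain ⟨m, ms, h1, h2⟩ := key (g :: gs) h
        exact ⟨(m + 1) :: ms, by simp [h1], by simp [toGaps, hb, h2, incHead]⟩

/-! ### Preservation of size -/

/-- The part of `gapSize` that depends on the word only. -/
def majSize : List Bool → ℕ
  | b :: w => (if brk b w then w.length else 0) + majSize w
  | [] => 0

/-- The part of `gapSize` that depends on the gaps only. -/
def weightedSum : List ℕ → ℕ
  | g :: gs => g * (gs.length + 1) + weightedSum gs
  | [] => 0

theorem gapSize_eq {w : List Bool} {gs : List ℕ} (h : gs.length = w.length) :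
    gapSize w gs = majSize w + weightedSum gs := by
  induction w generalizing gs with
  | nil => simp_all [gapSize, majSize, weightedSum]
  | cons b w ih =>
    match gs, h with
    | g :: gs, h =>
      have h := Nat.succ_injective h
      rw [gapSize, majSize, weightedSum, ih h, h]
      ring

/-- Weights count from the end of the list, so a new last entry raises every earlier weight by one.
-/
theorem weightedSum_append_singleton (l : List ℕ) (m : ℕ) :
    weightedSum (l ++ [m]) = weightedSum l + l.sum + m := by
  induction l with
  | nil => simp [weightedSum]
  | cons a l ih => simp [weightedSum, ih]; ring

theorem weightedSum_incHead (l : List ℕ) : weightedSum (incHead l) = weightedSum l + l.length := by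
  cases l with
  | nil => simp [weightedSum, incHead]
  | cons a l => simp [weightedSum, incHead]; ring

/-- Appending `m` costs `ms.sum + m`, since `toGaps` preserves sums. The remaining `w.length` comes
from `majSize` at a break; otherwise incrementing the head supplies `w.length + 1`, whose extra one
makes up for appending `m` in place of `m + 1`. -/
theorem gapSize_toGaps {w : List Bool} {ms : List ℕ} (h : ms.length = w.length) :
    gapSize w (toGaps w ms) = flatSize w ms := by
  rw [gapSize_eq (length_toGaps h)]
  induction w generalizing ms with
  | nil => simp [toGaps, majSize, weightedSum, flatSize]
  | cons b w ih =>
    match ms, h with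
    | m :: ms, h =>
      have h := Nat.succ_injective h
      have ih := ih h
      have hl := length_toGaps h
      have hs := sum_toGaps h
      rw [toGaps_cons, majSize, flatSize]
      by_cases hb : brk b w = true
      · simp only [hb, if_true, true_or, weightedSum_append_singleton]
        omega
      · cases m with
        | zero => simp [hb, weightedSum, ih]
        | succ m =>
          simp [hb, weightedSum_append_singleton, weightedSum_incHead]
          omega

/-! ### Partitions without multiples of `3` -/

/-- The weakly increasing list of parts not divisible by `3` with word `w` and gaps `gs`, where the
gaps are counted from the number `p`. -/
def gapParts : ℕ → List Bool → List ℕ → List ℕ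
  | p, b :: w, g :: gs =>
    let a := 3 * (p / 3 + g + if p % 3 = 2 ∧ b = false then 1 else 0) + letter b
    a :: gapParts a w gs
  | _, _, _ => []

theorem gapParts_cons (p : ℕ) (b : Bool) (w : List Bool) (g : ℕ) (gs : List ℕ) :
    ∃ a, gapParts p (b :: w) (g :: gs) = a :: gapParts a w gs ∧ a % 3 = letter b ∧
      a / 3 = p / 3 + g + if p % 3 = 2 ∧ b = false then 1 else 0 := by
  refine ⟨_, rfl, ?_, ?_⟩ <;> cases b <;> simp [letter] <;> omega

theorem letter_cases (b : Bool) : b = false ∧ letter b = 1 ∨ b = true ∧ letter b = 2 := by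
  cases b <;> simp [letter]

theorem le_of_mem_gapParts {p : ℕ} (hp : p % 3 ≠ 0) {w : List Bool} {gs : List ℕ} :
    (∀ a ∈ gapParts p w gs, p ≤ a ∧ a % 3 ≠ 0) ∧ (gapParts p w gs).Pairwise (· ≤ ·) := by
  induction w generalizing p gs with
  | nil => simp [gapParts]
  | cons b w ih =>
    match gs with
    | [] => simp [gapParts]
    | g :: gs =>
      obtain ⟨a, e, h1, h2⟩ := gapParts_cons p b w g gs
      have hb := letter_cases b
      have ha : a % 3 ≠ 0 := by omega
      have hpa : p ≤ a := by
        rcases hb with ⟨rfl, hb⟩ | ⟨rfl, hb⟩ <;> simp at h2 <;> [split_ifs at h2; skip] <;> omega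
      obtain ⟨i1, i2⟩ := ih ha (gs := gs)
      rw [e]
      refine ⟨?_, List.pairwise_cons.2 ⟨fun x hx => (i1 x hx).1, i2⟩⟩
      intro x hx
      rcases List.mem_cons.1 hx with rfl | hx
      · exact ⟨hpa, ha⟩
      · exact ⟨hpa.trans (i1 x hx).1, (i1 x hx).2⟩

theorem gapParts_injective {p : ℕ} {w w' : List Bool} {gs gs' : List ℕ}
    (h : gs.length = w.length) (h' : gs'.length = w'.length)
    (e : gapParts p w gs = gapParts p w' gs') : w = w' ∧ gs = gs' := by
  induction w generalizing p gs w' gs' with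
  | nil =>
    match w', gs', h' with
    | [], gs', h' => simp_all
    | b' :: w', g' :: gs', h' => simp [gapParts] at e
  | cons b w ih =>
    match gs, h, w', gs', h' with
    | g :: gs, h, [], _, _ => simp [gapParts] at e
    | g :: gs, h, b' :: w', g' :: gs', h' =>
      obtain ⟨a, e1, h1, h2⟩ := gapParts_cons p b w g gs
      obtain ⟨a', e1', h1', h2'⟩ := gapParts_cons p b' w' g' gs'
      rw [e1, e1'] at e
      obtain ⟨rfl, e⟩ := List.cons.inj e
      obtain ⟨rfl, rfl⟩ := ih (Nat.succ_injective h) (Nat.succ_injective h') e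
      have hb : b = b' := by
        rcases letter_cases b with ⟨rfl, hb⟩ | ⟨rfl, hb⟩ <;>
        rcases letter_cases b' with ⟨rfl, hb'⟩ | ⟨rfl, hb'⟩ <;> first | rfl | omega
      subst hb
      have : g = g' := by omega
      simp [this]

theorem exists_gapParts_eq {p : ℕ} (hp : p % 3 ≠ 0) {l : List ℕ}
    (hl : ∀ a ∈ l, p ≤ a ∧ a % 3 ≠ 0) (hs : l.Pairwise (· ≤ ·)) :
    ∃ (w : List Bool) (gs : List ℕ), gs.length = w.length ∧ gapParts p w gs = l := by
  induction l generalizing p with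
  | nil => exact ⟨[], [], rfl, rfl⟩
  | cons a l ih =>
    obtain ⟨hpa, ha⟩ := hl a (by simp)
    obtain ⟨hs1, hs2⟩ := List.pairwise_cons.1 hs
    obtain ⟨w, gs, h, e⟩ := ih ha (fun x hx => ⟨hs1 x hx, (hl x (by simp [hx])).2⟩) hs2
    refine ⟨decide (a % 3 = 2) :: w,
      (a / 3 - p / 3 - if p % 3 = 2 ∧ decide (a % 3 = 2) = false then 1 else 0) :: gs,
      by simp [h], ?_⟩
    obtain ⟨a', e1, h1, h2⟩ := gapParts_cons p (decide (a % 3 = 2)) w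
      (a / 3 - p / 3 - if p % 3 = 2 ∧ decide (a % 3 = 2) = false then 1 else 0) gs
    have : a' = a := by
      have e3 : a' % 3 = a % 3 := by
        by_cases h3 : a % 3 = 2 <;> simp [h3, letter] at h1 <;> omega
      have : a' / 3 = a / 3 := by
        rw [h2]
        split_ifs with h4
        · have : a % 3 ≠ 2 := by simpa using h4.2
          omega
        · omega
      omega
    rw [e1, this, e]

theorem countP_gapParts {p : ℕ} {w : List Bool} {gs : List ℕ} (h : gs.length = w.length) :
    (gapParts p w gs).countP (fun a => a ≡ 1 [MOD 3]) = w.count false ∧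
    (gapParts p w gs).countP (fun a => a ≡ 2 [MOD 3]) = w.count true := by
  induction w generalizing p gs with
  | nil => simp [gapParts]
  | cons b w ih =>
    match gs, h with
    | g :: gs, h =>
      obtain ⟨a, e, h1, -⟩ := gapParts_cons p b w g gs
      obtain ⟨i1, i2⟩ := ih (p := a) (Nat.succ_injective h)
      rw [e, List.countP_cons, List.countP_cons, i1, i2]
      cases b <;> simp [letter] at h1 <;> simp [Nat.ModEq, h1]

/-- A rise of the quotient at one part is inherited by all later parts, hence is weighted by their
number. The `brk` term is the forced rise from `p` to the first part; for the empty word it is zero,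
as the length is. -/
theorem sum_gapParts {p : ℕ} (hp : p % 3 ≠ 0) {w : List Bool} {gs : List ℕ}
    (h : gs.length = w.length) :
    (gapParts p w gs).sum = w.count false + 2 * w.count true + 3 * (w.length * (p / 3) +
      (if brk (decide (p % 3 = 2)) w then w.length else 0) + gapSize w gs) := by
  induction w generalizing p gs with
  | nil => simp [gapParts, gapSize]
  | cons b w ih =>
    match gs, h with
    | g :: gs, h =>
      obtain ⟨a, e, h1, h2⟩ := gapParts_cons p b w g gs
      have ha : a % 3 ≠ 0 := by have := letter_cases b; omega
      have hd : decide (a % 3 = 2) = b := by cases b <;> simp [letter] at h1 <;> simp [h1]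
      have hw : w.length * (a / 3) = w.length * (p / 3) + g * w.length +
          if p % 3 = 2 ∧ b = false then w.length else 0 := by
        rw [h2]; split_ifs <;> ring
      rw [e, List.sum_cons, ih ha (Nat.succ_injective h), gapSize, hd, hw]
      have ea : a = 3 * (a / 3) + letter b := by omega
      have hk : brk (decide (p % 3 = 2)) (b :: w) = true ↔ p % 3 = 2 ∧ b = false := by
        by_cases h3 : p % 3 = 2 <;> cases b <;> simp [brk, h3]
      simp only [hk, List.length_cons]
      have hc : letter b + w.count false + 2 * w.count true =
          (b :: w).count false + 2 * (b :: w).count true := by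
        cases b <;> simp [letter] <;> ring
      rw [h2] at ea
      have e1 : g * (w.length + 1) = g * w.length + g := by ring
      have e2 : (w.length + 1) * (p / 3) = w.length * (p / 3) + p / 3 := by ring
      rw [e1, e2]
      split_ifs at ea ⊢ <;> omega

/-! ### Partitions with parts repeated at most twice -/

/-- Add one to the first `letter b` terms. -/
def inc (b : Bool) (f : ℕ → ℕ) (j : ℕ) : ℕ := f j + if j < letter b then 1 else 0

/-- Prepend three terms equal to `f 0 + m`. -/
def shift (m : ℕ) (f : ℕ → ℕ) (j : ℕ) : ℕ := if j < 3 then f 0 + m else f (j - 3)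

/-- The weakly decreasing sequence (the conjugate of a flat partition) with word `w` in which the
letters are separated by `ms` multiples of `3`. -/
def flatSeq : List Bool → List ℕ → ℕ → ℕ
  | b :: w, m :: ms =>
    inc b (if brk b w ∨ m ≠ 0 then shift m (flatSeq w ms) else flatSeq w ms)
  | _, _ => 0

theorem flatSeq_cons (b : Bool) (w : List Bool) (m : ℕ) (ms : List ℕ) :
    flatSeq (b :: w) (m :: ms) =
      inc b (if brk b w ∨ m ≠ 0 then shift m (flatSeq w ms) else flatSeq w ms) := rfl

theorem flatSeq_nil (ms : List ℕ) : flatSeq [] ms = 0 := rfl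

/-- Weakly decreasing sequences without three equal nonzero terms. -/
structure IsFlat (f : ℕ → ℕ) : Prop where
  le : ∀ j, f (j + 1) ≤ f j
  eq_zero : ∀ j, f (j + 2) = f j → f j = 0

theorem shift_zero (m : ℕ) (f : ℕ → ℕ) : shift m f 0 = f 0 + m := rfl
theorem shift_one (m : ℕ) (f : ℕ → ℕ) : shift m f 1 = f 0 + m := rfl
theorem shift_two (m : ℕ) (f : ℕ → ℕ) : shift m f 2 = f 0 + m := rfl
theorem shift_add_three (m : ℕ) (f : ℕ → ℕ) (j : ℕ) : shift m f (j + 3) = f j := by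
  simp [shift]

theorem inc_zero (b : Bool) (f : ℕ → ℕ) : inc b f 0 = f 0 + 1 := by
  cases b <;> simp [inc, letter]
theorem inc_one (b : Bool) (f : ℕ → ℕ) : inc b f 1 = f 1 + if b then 1 else 0 := by
  cases b <;> simp [inc, letter]
theorem inc_add_two (b : Bool) (f : ℕ → ℕ) (j : ℕ) : inc b f (j + 2) = f (j + 2) := by
  cases b <;> simp [inc, letter]

theorem inc_injective (b : Bool) : Function.Injective (inc b) := by
  intro f g h
  ext j
  have := congrFun h j
  simpa [inc] using this

/-- What is known about the first terms of `flatSeq w ms`. -/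
def HeadSpec : List Bool → (ℕ → ℕ) → Prop
  | [], f => f = 0
  | false :: _, f => f 1 < f 0 ∧ f 2 < f 0
  | true :: _, f => f 1 = f 0 ∧ f 2 < f 0

theorem IsFlat.of_tail {f : ℕ → ℕ} (h : IsFlat fun j => f (j + 1)) (h1 : f 1 ≤ f 0)
    (h2 : f 2 = f 0 → f 0 = 0) : IsFlat f := by
  constructor <;> intro j <;> rcases j with _ | j
  · exact h1
  · exact h.le j
  · exact h2
  · exact h.eq_zero j

theorem IsFlat.of_tail_two {f : ℕ → ℕ} (h : IsFlat fun j => f (j + 2)) (h1 : f 1 ≤ f 0)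
    (h2 : f 2 ≤ f 1) (h3 : f 2 = f 0 → f 0 = 0) (h4 : f 3 = f 1 → f 1 = 0) : IsFlat f :=
  .of_tail (.of_tail h h2 h4) h1 h3

theorem IsFlat.tail {f : ℕ → ℕ} (h : IsFlat f) (i : ℕ) : IsFlat fun j => f (j + i) := by
  constructor <;> intro j
  · simpa only [add_right_comm] using h.le (j + i)
  · simpa only [add_right_comm] using h.eq_zero (j + i)

theorem IsFlat.initial {f : ℕ → ℕ} (h : IsFlat f) : f 1 ≤ f 0 ∧ f 2 ≤ f 1 ∧ f 3 ≤ f 2 ∧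
    (f 2 = f 0 → f 0 = 0) ∧ (f 3 = f 1 → f 1 = 0) ∧ (f 4 = f 2 → f 2 = 0) :=
  ⟨h.le 0, h.le 1, h.le 2, h.eq_zero 0, h.eq_zero 1, h.eq_zero 2⟩

/-- Flatness and the shape of the head go through one induction: whether a new letter creates three
equal nonzero terms depends on the next letter, which the head reveals. -/
theorem headSpec_flatSeq {w : List Bool} {ms : List ℕ} (h : ms.length = w.length) :
    IsFlat (flatSeq w ms) ∧ HeadSpec w (flatSeq w ms) := by
  induction w generalizing ms with
  | nil => exact ⟨⟨fun j => le_rfl, fun j _ => rfl⟩, rfl⟩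
  | cons b w ih =>
    match ms, h with
    | m :: ms, h =>
      obtain ⟨hf, h3⟩ := ih (Nat.succ_injective h)
      rw [flatSeq_cons]
      generalize flatSeq w ms = f at hf h3
      have ini := hf.initial
      by_cases hb : brk b w = true ∨ m ≠ 0
      · rw [if_pos hb]
        have i0 : inc b (shift m f) 0 = f 0 + m + 1 := inc_zero _ _
        have i1 : inc b (shift m f) 1 = f 0 + m + if b then 1 else 0 := inc_one _ _
        have i2 : inc b (shift m f) 2 = f 0 + m := inc_add_two _ _ _
        have i3 : ∀ j, inc b (shift m f) (j + 3) = f j := fun j =>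
          (inc_add_two _ _ _).trans (shift_add_three _ _ _)
        have i30 : inc b (shift m f) 3 = f 0 := i3 0
        have i31 : inc b (shift m f) 4 = f 1 := i3 1
        refine ⟨.of_tail_two (.of_tail (by simpa only [add_assoc, Nat.reduceAdd, i3] using hf)
          ?_ ?_) ?_ ?_ ?_ ?_, ?_⟩
        · simp only [zero_add, Nat.reduceAdd]; omega
        · simp only [zero_add, Nat.reduceAdd]
          rw [i31, i2]
          intro e
          rcases hb with hb | hb
          · match b, w, h3 with
            | _, [], h3 => have : f 0 = 0 := congrFun h3 0; omega
            | true, false :: _, h3 => have := h3.1; omega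
            | true, true :: _, h3 => simp [brk] at hb
            | false, _ :: _, h3 => simp [brk] at hb
          · omega
        · rw [i0, i1]; split_ifs <;> omega
        · omega
        · omega
        · rw [i30, i1]
          intro e
          rcases hb with hb | hb
          · match b, w, h3 with
            | _, [], h3 => have : f 0 = 0 := congrFun h3 0; omega
            | true, _ :: _, h3 => simp at e; omega
            | false, _ :: _, h3 => simp [brk] at hb
          · omega
        · cases b <;> simp [HeadSpec, i0, i1, i2]
      · rw [if_neg hb]
        push Not at hb
        obtain ⟨hb, -⟩ := hb
        have hbw : (b = false ∧ f 2 < f 0) ∨ (b = true ∧ f 1 = f 0 ∧ f 2 < f 0) := by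
          match b, w, h3 with
          | _, [], h3 => simp [brk] at hb
          | true, false :: _, h3 => simp [brk] at hb
          | true, true :: _, h3 => exact Or.inr ⟨rfl, h3⟩
          | false, false :: _, h3 => exact Or.inl ⟨rfl, h3.2⟩
          | false, true :: _, h3 => exact Or.inl ⟨rfl, h3.2⟩
        have i0 := inc_zero b f
        have i1 := inc_one b f
        have i2 : inc b f 2 = f 2 := inc_add_two _ _ _
        have i3 : inc b f 3 = f 3 := inc_add_two _ _ _
        refine ⟨.of_tail_two (by simpa only [inc_add_two] using hf.tail 2) ?_ ?_ ?_ ?_, ?_⟩ <;>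
        rcases hbw with ⟨rfl, h4⟩ | ⟨rfl, h4⟩ <;> simp [HeadSpec] at i1 ⊢ <;> omega

theorem HeadSpec.cons {b : Bool} {w : List Bool} {f : ℕ → ℕ} (h : HeadSpec (b :: w) f) :
    f 2 < f 0 ∧ (b = true ↔ f 1 = f 0) := by
  cases b
  · exact ⟨h.2, by simpa using h.1.ne⟩
  · exact ⟨h.2, by simpa using h.1⟩

/-- The head determines the first letter. Once it is removed, terms 0 and 2 agree after a shift and
differ otherwise, so the branch can be recovered too. -/
theorem flatSeq_injective {w w' : List Bool} {ms ms' : List ℕ}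
    (h : ms.length = w.length) (h' : ms'.length = w'.length)
    (e : flatSeq w ms = flatSeq w' ms') : w = w' ∧ ms = ms' := by
  induction w generalizing ms w' ms' with
  | nil =>
    match w', ms', h' with
    | [], ms', h' => simp_all
    | b' :: w', g' :: gs', h' =>
      have := (headSpec_flatSeq h').2.cons.1
      rw [← e] at this
      simp [flatSeq_nil] at this
  | cons b w ih =>
    have s1 := (headSpec_flatSeq h).2.cons
    match ms, h, w', ms', h' with
    | m :: ms, h, [], _, _ =>
      rw [e] at s1
      simp [flatSeq_nil] at s1
    | m :: ms, h, b' :: w', m' :: ms', h' =>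
      have s2 := (headSpec_flatSeq h').2.cons
      rw [← e] at s2
      obtain rfl : b = b' := Bool.eq_iff_iff.2 (s1.2.trans s2.2.symm)
      rw [flatSeq_cons, flatSeq_cons] at e
      have e := inc_injective b e
      have hl := Nat.succ_injective h
      have hl' := Nat.succ_injective h'
      have key : ∀ {w : List Bool} {m : ℕ} {ms : List ℕ}, ms.length = w.length →
          ¬ (brk b w = true ∨ m ≠ 0) → m = 0 ∧ flatSeq w ms 2 < flatSeq w ms 0 := by
        intro w m ms hl hb
        push Not at hb
        match w, hb with
        | [], hb => simp [brk] at hb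
        | c :: w, hb => exact ⟨hb.2, (headSpec_flatSeq hl).2.cons.1⟩
      split_ifs at e with c1 c2 c2
      · have : flatSeq w ms = flatSeq w' ms' := by
          ext j; simpa only [shift_add_three] using congrFun e (j + 3)
        obtain ⟨rfl, rfl⟩ := ih hl hl' this
        have := congrFun e 0
        simp only [shift_zero] at this
        simp; omega
      · have := (key hl' c2).2
        rw [← e, shift_zero, shift_two] at this
        omega
      · have := (key hl c1).2
        rw [e, shift_zero, shift_two] at this
        omega
      · obtain ⟨rfl, rfl⟩ := ih hl hl' e
        simp [(key hl c1).1, (key hl' c2).1]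

theorem exists_flatSeq_eq {f : ℕ → ℕ} (hf : IsFlat f) :
    ∃ (w : List Bool) (ms : List ℕ), ms.length = w.length ∧ flatSeq w ms = f := by
  -- `f 0` is the number of parts of the conjugate; removing the smallest part lowers it.
  induction hN : f 0 using Nat.strong_induction_on generalizing f with
  | _ N ih =>
    subst hN
    have hanti : Antitone f := antitone_nat_of_succ_le hf.le
    rcases Nat.eq_zero_or_pos (f 0) with h0 | h0
    · refine ⟨[], [], rfl, ?_⟩
      ext j
      have := hanti (Nat.zero_le j)
      simp [flatSeq_nil]
      omega
    have ini := hf.initial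
    -- The smallest part of the conjugate is 2 exactly when it has no part 1, that is, when `f 1 = f
    -- 0`.
    obtain ⟨b, hb⟩ : ∃ b : Bool, b = true ↔ f 1 = f 0 := ⟨decide (f 1 = f 0), by simp⟩
    set g : ℕ → ℕ := fun j => f j - if j < letter b then 1 else 0 with hg
    have hfg : f = inc b g := by
      ext j
      rcases j with _ | _ | j <;> cases b <;> simp [inc, hg, letter] at hb ⊢ <;> omega
    have g0 : g 0 = f 0 - 1 := by cases b <;> simp [hg, letter]
    have g1 : g 1 = f 1 - if b then 1 else 0 := by cases b <;> simp [hg, letter]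
    have g2 : ∀ j, g (j + 2) = f (j + 2) := by intro j; cases b <;> simp [hg, letter]
    have g20 := g2 0
    simp only [zero_add] at g20
    by_cases h02 : g 0 = g 2
    · have hg1 : g 1 = g 0 := by
        rw [g1]
        rcases Bool.eq_false_or_eq_true b with rfl | rfl <;> simp at hb ⊢ <;> omega
      obtain ⟨w, ms, hl, e⟩ := ih (f 3) (by omega) (f := fun j => f (j + 3))
        ⟨fun j => hf.le _, fun j => hf.eq_zero (j + 3)⟩ rfl
      refine ⟨b :: w, (f 2 - f 3) :: ms, by simp [hl], ?_⟩
      -- With neither a break nor multiples of 3, `f` would have three equal nonzero terms, starting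
      -- at index 1 or 2.
      have hcond : brk b w = true ∨ f 2 - f 3 ≠ 0 := by
        by_contra hc
        push Not at hc
        obtain ⟨hc1, hc2⟩ := hc
        have hs := (headSpec_flatSeq hl).2
        rw [e] at hs
        match b, w, hs with
        | _, [], _ => simp [brk] at hc1
        | true, false :: _, _ => simp [brk] at hc1
        | _, true :: _, hs =>
          have : f 4 = f 3 := hs.1
          have := hs.2
          simp only [zero_add] at this
          omega
        | false, _ :: _, hs =>
          have := hs.cons.1
          simp only [zero_add] at this
          simp at g1 hb
          omega
      rw [flatSeq_cons, if_pos hcond, e]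
      refine Eq.trans ?_ hfg.symm
      congr 1
      ext j
      rcases j with _ | _ | _ | j
      · rw [shift_zero]; simp only [zero_add]; omega
      · rw [zero_add, shift_one]; simp only [zero_add]; omega
      · rw [zero_add, shift_two]; simp only [zero_add, Nat.reduceAdd]; omega
      · rw [shift_add_three, g2 j.succ]
    · have gflat : IsFlat g := by
        have g3 : g 3 = f 3 := g2 1
        refine .of_tail_two (by simpa only [g2] using hf.tail 2) ?_ ?_ ?_ ?_ <;>
        cases b <;> simp at hb g1 <;> omega
      obtain ⟨w, ms, hl, e⟩ := ih (g 0) (by omega) gflat rfl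
      refine ⟨b :: w, 0 :: ms, by simp [hl], ?_⟩
      have hcond : ¬ (brk b w = true ∨ 0 ≠ 0) := by
        have hs := (headSpec_flatSeq hl).2
        rw [e] at hs
        have gl := gflat.le 0
        have gl' := gflat.le 1
        match b, w, hs with
        | _, [], hs =>
          have : g 0 = 0 := congrFun hs 0
          simp only [zero_add, Nat.reduceAdd] at gl gl'
          omega
        | true, false :: _, hs =>
          have := hs.1
          simp at g1 hb
          omega
        | true, true :: _, hs => simp [brk]
        | false, _ :: _, hs => simp [brk]
      rw [flatSeq_cons, if_neg hcond, e, ← hfg]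

theorem flatSeq_zero {w : List Bool} {ms : List ℕ} (h : ms.length = w.length) :
    flatSeq w ms 0 = w.length + ms.sum := by
  induction w generalizing ms with
  | nil => simp_all [flatSeq_nil]
  | cons b w ih =>
    match ms, h with
    | m :: ms, h =>
      have := ih (Nat.succ_injective h)
      rw [flatSeq_cons, inc_zero]
      split_ifs with hb
      · rw [shift_zero, this]; simp; ring
      · simp at hb; simp [this, hb]; ring

theorem flatSeq_eq_zero {w : List Bool} {ms : List ℕ} (h : ms.length = w.length) {j : ℕ}
    (hj : 3 * w.length ≤ j) : flatSeq w ms j = 0 := by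
  induction w generalizing ms j with
  | nil => simp [flatSeq_nil]
  | cons b w ih =>
    match ms, h with
    | m :: ms, h =>
      have hl := Nat.succ_injective h
      obtain ⟨j, rfl⟩ : ∃ i, j = i + 3 := ⟨j - 3, by simp at hj; omega⟩
      simp at hj
      rw [flatSeq_cons, inc_add_two _ _ (j + 1)]
      split_ifs
      · rw [shift_add_three, ih hl (by omega)]
      · rw [ih hl (by omega)]

/-! ### Type and size of a flat sequence -/

/-- The sum over the first `B` blocks of three terms of `f` of the function `u` of the block. -/
def blockSum (u : ℕ → ℕ → ℕ → ℕ) (B : ℕ) (f : ℕ → ℕ) : ℕ :=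
  ∑ k ∈ Finset.range B, u (f (3 * k)) (f (3 * k + 1)) (f (3 * k + 2))

/-- Only block 0 changes. Its old and new values sit on opposite sides so that no subtraction is
needed. -/
theorem blockSum_inc (u : ℕ → ℕ → ℕ → ℕ) (B : ℕ) (b : Bool) (f : ℕ → ℕ) :
    blockSum u (B + 1) (inc b f) + u (f 0) (f 1) (f 2) =
      blockSum u (B + 1) f + u (f 0 + 1) (f 1 + if b then 1 else 0) (f 2) := by
  simp only [blockSum, Finset.sum_range_succ', mul_zero, zero_add, inc_zero, inc_one,
    inc_add_two _ _ 0]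
  have : ∀ k, inc b f (3 * (k + 1)) = f (3 * (k + 1)) ∧
      inc b f (3 * (k + 1) + 1) = f (3 * (k + 1) + 1) ∧
      inc b f (3 * (k + 1) + 2) = f (3 * (k + 1) + 2) := fun k =>
    ⟨inc_add_two b f (3 * k + 1), inc_add_two b f (3 * k + 2), inc_add_two b f (3 * k + 3)⟩
  simp only [this]
  ring

theorem blockSum_shift (u : ℕ → ℕ → ℕ → ℕ) (B m : ℕ) (f : ℕ → ℕ) :
    blockSum u (B + 1) (shift m f) = blockSum u B f + u (f 0 + m) (f 0 + m) (f 0 + m) := by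
  simp only [blockSum, Finset.sum_range_succ', mul_zero, zero_add, shift_zero, shift_one,
    shift_two]
  have : ∀ k, shift m f (3 * (k + 1)) = f (3 * k) ∧
      shift m f (3 * (k + 1) + 1) = f (3 * k + 1) ∧
      shift m f (3 * (k + 1) + 2) = f (3 * k + 2) := fun k =>
    ⟨shift_add_three m f (3 * k), shift_add_three m f (3 * k + 1), shift_add_three m f (3 * k + 2)⟩
  simp only [this]

/-- A shift adds a constant block, invisible to both alternating sums, whose total is three times
`w.length + ms.sum + m` by `flatSeq_zero`; this is the summand of `flatSize`. The letter then adds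
one to exactly one of the alternating sums. -/
theorem blockSum_flatSeq {w : List Bool} {ms : List ℕ} (h : ms.length = w.length) {B : ℕ}
    (hB : w.length ≤ B) :
    blockSum (fun x y _ => x - y) B (flatSeq w ms) = w.count false ∧
    blockSum (fun _ y z => y - z) B (flatSeq w ms) = w.count true ∧
    blockSum (fun x y z => x + y + z) B (flatSeq w ms) =
      w.count false + 2 * w.count true + 3 * flatSize w ms := by
  induction w generalizing ms B with
  | nil => simp [flatSeq_nil, blockSum, flatSize]
  | cons b w ih =>
    match ms, h with
    | m :: ms, h =>
      have hl := Nat.succ_injective h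
      obtain ⟨B, rfl⟩ : ∃ i, B = i + 1 := ⟨B - 1, by simp at hB; omega⟩
      simp at hB
      rw [flatSeq_cons, flatSize]
      have k1 := fun f => blockSum_inc (fun x y _ => x - y) B b f
      have k2 := fun f => blockSum_inc (fun _ y z => y - z) B b f
      have k3 := fun f => blockSum_inc (fun x y z => x + y + z) B b f
      by_cases hb : brk b w = true ∨ m ≠ 0
      · simp only [if_pos hb]
        obtain ⟨i1, i2, i3⟩ := ih hl hB
        specialize k1 (shift m (flatSeq w ms))
        specialize k2 (shift m (flatSeq w ms))
        specialize k3 (shift m (flatSeq w ms))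
        simp only [blockSum_shift, i1, i2, i3, shift_zero, shift_one, shift_two] at k1 k2 k3
        rw [flatSeq_zero hl] at k1 k2 k3
        cases b <;> simp at k1 k2 k3 ⊢ <;> omega
      · simp only [if_neg hb]
        obtain ⟨i1, i2, i3⟩ := ih hl (B := B + 1) (by omega)
        obtain ⟨⟨h1, -⟩, h3⟩ := headSpec_flatSeq hl
        specialize k1 (flatSeq w ms)
        specialize k2 (flatSeq w ms)
        specialize k3 (flatSeq w ms)
        have h10 := h1 0
        have h11 := h1 1
        simp only [i1, i2, i3] at k1 k2 k3
        simp only [zero_add, Nat.reduceAdd] at h10 h11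
        cases b <;> simp at k1 k2 k3 ⊢ <;> omega

/-! ### Partitions as sequences -/

section Sequence

variable {n : ℕ} (p : n.Partition)

theorem part_eq_zero {j : ℕ} (hj : p.parts.card ≤ j) : part p j = 0 :=
  List.getD_eq_default _ _ (by simpa using hj)

theorem sum_range_part {B : ℕ} (hB : p.parts.card ≤ B) : ∑ j ∈ Finset.range B, part p j = n := by
  have h1 : ∑ j ∈ Finset.range p.parts.card, part p j = n := by
    have hs : (p.parts.sort (fun a b => b ≤ a)).sum = n := by
      rw [← Multiset.sum_coe, Multiset.sort_eq, p.parts_sum]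
    have hl : (p.parts.sort (fun a b => b ≤ a)).length = p.parts.card := by simp
    rw [← hl, Finset.sum_range]
    refine Eq.trans ?_ ((Fin.sum_univ_getElem _).trans hs)
    exact Finset.sum_congr rfl fun i _ => List.getD_eq_getElem _ _ i.2
  refine Eq.trans (Eq.symm ?_) h1
  apply Finset.sum_subset (Finset.range_mono hB)
  intro j _ hj
  exact part_eq_zero p (by simpa using hj)

theorem part_injective : Function.Injective (part (n := n)) := by
  intro p q h
  have hsupp : ∀ r : n.Partition, ∀ j, j < r.parts.card ↔ part r j ≠ 0 := by
    intro r j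
    constructor
    · intro hj
      have hj' : j < (r.parts.sort (fun a b => b ≤ a)).length := by simpa using hj
      unfold part
      rw [List.getD_eq_getElem _ _ hj']
      exact (r.parts_pos (by
        rw [← Multiset.mem_sort (r := fun a b => b ≤ a)]; exact List.getElem_mem hj')).ne'
    · intro hj
      by_contra hc
      exact hj (part_eq_zero r (not_lt.1 hc))
  have hcard : p.parts.card = q.parts.card := by
    apply eq_of_forall_lt_iff
    intro j
    rw [hsupp, hsupp, h]
  have : p.parts.sort (fun a b => b ≤ a) = q.parts.sort (fun a b => b ≤ a) := by
    apply List.ext_getElem (by simpa using hcard)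
    intro j h1 h2
    have := congrFun h j
    unfold part at this
    rwa [List.getD_eq_getElem _ _ h1, List.getD_eq_getElem _ _ h2] at this
  ext1
  rw [← Multiset.sort_eq p.parts (fun a b => b ≤ a), this, Multiset.sort_eq]

theorem exists_part_eq {f : ℕ → ℕ} (hf : Antitone f) {B : ℕ} (hB : ∀ j, B ≤ j → f j = 0)
    (hn : ∑ j ∈ Finset.range B, f j = n) : ∃ p : n.Partition, part p = f := by
  -- `r` is the first index where `f` vanishes, hence the number of parts.
  obtain ⟨r, hr⟩ : ∃ r, ∀ j, j < r ↔ f j ≠ 0 := by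
    classical
    have hex : ∃ j, f j = 0 := ⟨B, hB B le_rfl⟩
    refine ⟨Nat.find hex, fun j => ⟨fun hj => Nat.find_min hex hj, fun hj => ?_⟩⟩
    by_contra hc
    have := hf (not_lt.1 hc)
    rw [Nat.find_spec hex] at this
    omega
  have hrB : r ≤ B := by
    by_contra hc
    exact (hr B).1 (not_le.1 hc) (hB B le_rfl)
  have hsum : ∑ j ∈ Finset.range r, f j = n := by
    rw [← hn]
    apply Finset.sum_subset (Finset.range_mono hrB)
    intro j _ hj
    by_contra hc
    exact hj (by simpa using (hr j).2 hc)
  refine ⟨⟨((List.range r).map f : List ℕ), ?_, ?_⟩, ?_⟩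
  · intro i hi
    obtain ⟨j, hj, rfl⟩ : ∃ j < r, f j = i := by simpa using hi
    exact Nat.pos_of_ne_zero ((hr j).1 hj)
  · rw [Multiset.sum_coe, ← hsum]
    rfl
  · ext j
    have hs : Multiset.sort ((List.range r).map f : Multiset ℕ) (fun a b => b ≤ a) =
        (List.range r).map f := by
      apply List.Perm.eq_of_pairwise' (r := fun a b : ℕ => b ≤ a)
      · exact Multiset.pairwise_sort _ _
      · exact List.pairwise_lt_range.map _ fun a b hab => hf hab.le
      · exact Multiset.coe_eq_coe.1 (Multiset.sort_eq _ _)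
    unfold part
    rw [hs]
    by_cases hj : j < r
    · rw [List.getD_eq_getElem _ _ (by simpa using hj)]; simp
    · rw [List.getD_eq_default _ _ (by simpa using hj)]
      by_contra hc
      exact hj ((hr j).2 (Ne.symm hc))

theorem isFlat_part_iff :
    IsFlat (part p) ↔ p ∈ Nat.Partition.countRestricted n 3 := by
  have hcount : ∀ v, p.parts.count v = (p.parts.sort (fun a b => b ≤ a)).count v := by
    intro v
    rw [← Multiset.coe_count, Multiset.sort_eq]
  rw [Nat.Partition.countRestricted, Finset.mem_filter]
  simp only [Finset.mem_univ, true_and]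
  set l := p.parts.sort (fun a b => b ≤ a) with hl
  constructor
  · intro h v hv
    rw [hcount]
    by_contra hc
    have hsub := List.replicate_sublist_iff.2 (not_lt.1 hc)
    -- Three copies of `v` occupy increasing positions; monotonicity squeezes the term two places
    -- after the first to `v`, against flatness.
    obtain ⟨g, hg⟩ := List.sublist_iff_exists_fin_orderEmbedding_get_eq.1 hsub
    have hval : ∀ i : Fin (List.replicate 3 v).length, part p (g i) = v := by
      intro i
      unfold part
      rw [List.getD_eq_getElem _ _ (g i).2]
      have := hg i
      rw [List.get_eq_getElem, List.getElem_replicate] at this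
      exact this.symm
    have hlt : ∀ a b : Fin (List.replicate 3 v).length, a < b → (g a : ℕ) < g b :=
      fun a b hab => g.strictMono hab
    have h0 := hlt ⟨0, by simp⟩ ⟨1, by simp⟩ (by simp)
    have h1 := hlt ⟨1, by simp⟩ ⟨2, by simp⟩ (by simp)
    have hle := part_antitone p (show (g ⟨0, by simp⟩ : ℕ) + 2 ≤ g ⟨2, by simp⟩ by omega)
    have hle' := part_antitone p (show (g ⟨0, by simp⟩ : ℕ) ≤ g ⟨0, by simp⟩ + 2 by omega)
    have := h.eq_zero (g ⟨0, by simp⟩)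
    rw [hval] at *
    have := p.parts_pos hv
    omega
  · intro h
    refine ⟨fun j => part_antitone p j.le_succ, fun j hj => ?_⟩
    by_contra hc
    have hlen : j + 2 < l.length := by
      by_contra hlen
      exact hc (hj ▸ part_eq_zero p (by simpa [hl] using hlen))
    have hmem : part p j ∈ p.parts := by
      unfold part
      rw [← hl, List.getD_eq_getElem _ _ (by omega),
        ← Multiset.mem_sort (r := fun a b => b ≤ a)]
      exact List.getElem_mem _
    have hlt := h _ hmem
    rw [hcount] at hlt
    have e1 : part p (j + 1) = part p j :=
      le_antisymm (part_antitone p (by omega)) (hj ▸ part_antitone p (by omega))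
    have hget : ∀ i (hi : i < l.length), l[i] = part p i := fun i hi =>
      (List.getD_eq_getElem _ _ hi).symm
    have hdrop : l.drop j = part p j :: part p j :: part p j :: l.drop (j + 3) := by
      rw [List.drop_eq_getElem_cons (by omega), List.drop_eq_getElem_cons (by omega),
        List.drop_eq_getElem_cons (by omega), hget, hget, hget, e1]
      rw [add_assoc, hj]
    have := (List.drop_sublist j l).count_le (part p j)
    rw [hdrop] at this
    simp at this
    omega

theorem altSum_eq_blockSum {B : ℕ} (hB : p.parts.card ≤ B) :
    altSum 3 p 1 = blockSum (fun x y _ => x - y) B (part p) ∧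
    altSum 3 p 2 = blockSum (fun _ y z => y - z) B (part p) := by
  constructor
  all_goals
    unfold altSum blockSum
    rw [← Finset.sum_subset (Finset.range_mono hB)]
    · apply Finset.sum_congr rfl
      intro k _
      simp [mul_comm k 3]
    · intro k _ hk
      simp at hk
      simp [part_eq_zero p (j := 3 * k) (by omega), part_eq_zero p (j := 3 * k + 1) (by omega)]

theorem blockSum_add (B : ℕ) (f : ℕ → ℕ) :
    blockSum (fun x y z => x + y + z) B f = ∑ j ∈ Finset.range (3 * B), f j := by
  unfold blockSum
  induction B with
  | zero => simp
  | succ B ih =>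
    rw [Finset.sum_range_succ, ih, mul_add, mul_one, Finset.sum_range_succ, Finset.sum_range_succ,
      Finset.sum_range_succ]
    ring

end Sequence

/-! ### Counting -/

/-- The words with `s` letters `false` and `t` letters `true`, together with a number for each
letter, for which the size function `e` gives total size `n`. -/
def codes (e : List Bool → List ℕ → ℕ) (s t n : ℕ) : Set (List Bool × List ℕ) :=
  {c | c.2.length = c.1.length ∧ c.1.count false = s ∧ c.1.count true = t ∧
    s + 2 * t + 3 * e c.1 c.2 = n}

theorem ncard_codes (s t n : ℕ) : (codes flatSize s t n).ncard = (codes gapSize s t n).ncard := by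
  refine Set.ncard_congr (fun c _ => (c.1, toGaps c.1 c.2)) ?_ ?_ ?_
  · rintro ⟨w, ms⟩ ⟨h1, h2, h3, h4⟩
    exact ⟨length_toGaps h1, h2, h3, by rw [gapSize_toGaps h1]; exact h4⟩
  · rintro ⟨w, ms⟩ ⟨w', ms'⟩ h h' e
    obtain ⟨e1, e⟩ := Prod.mk.inj e
    simp only at e1 e
    subst e1
    exact congrArg _ (toGaps_injOn h.1 h'.1 e)
  · rintro ⟨w, gs⟩ ⟨h1, h2, h3, h4⟩
    simp only at h1 h2 h3 h4
    obtain ⟨ms, hl, rfl⟩ := exists_toGaps_eq h1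
    exact ⟨(w, ms), ⟨hl, h2, h3, by rw [← gapSize_toGaps hl]; exact h4⟩, rfl⟩

theorem numAltSumType_eq_ncard (s t n : ℕ) :
    numAltSumType s t n = (codes flatSize s t n).ncard := by
  rw [numAltSumType, ← Set.ncard_coe_finset, ← Set.ncard_image_of_injective _ part_injective,
    ← Set.InjOn.ncard_image (s := codes flatSize s t n) (f := fun c => flatSeq c.1 c.2)]
  · congr 1
    ext f
    constructor
    · rintro ⟨p, hp, rfl⟩
      simp only [Finset.coe_filter, Set.mem_ofPred_eq] at hp
      obtain ⟨hp, rfl, rfl⟩ := hp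
      obtain ⟨w, ms, hl, e⟩ := exists_flatSeq_eq ((isFlat_part_iff p).2 hp)
      refine ⟨(w, ms), ⟨hl, ?_⟩, e⟩
      -- The maximum gives a number of blocks large enough for both descriptions; further blocks are
      -- zero.
      obtain ⟨a1, a2⟩ := altSum_eq_blockSum p (le_max_right w.length p.parts.card)
      obtain ⟨b1, b2, b3⟩ := blockSum_flatSeq hl (le_max_left w.length p.parts.card)
      have hn := sum_range_part p (B := 3 * max w.length p.parts.card) (by omega)
      rw [← blockSum_add] at hn
      rw [e] at b1 b2 b3
      exact ⟨by rw [a1, b1], by rw [a2, b2], by rw [a1, a2, b1, b2, ← b3, hn]⟩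
    · rintro ⟨⟨w, ms⟩, ⟨hl, hs, ht, hn⟩, rfl⟩
      simp only at hl hs ht hn ⊢
      have hflat := (headSpec_flatSeq hl).1
      obtain ⟨-, -, b3⟩ := blockSum_flatSeq hl le_rfl
      rw [hs, ht, hn, blockSum_add] at b3
      obtain ⟨p, e⟩ := exists_part_eq (antitone_nat_of_succ_le hflat.le)
        (fun j hj => flatSeq_eq_zero hl hj) b3
      refine ⟨p, ?_, e⟩
      simp only [Finset.coe_filter, Set.mem_ofPred_eq]
      obtain ⟨a1, a2⟩ := altSum_eq_blockSum p (le_max_right w.length p.parts.card)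
      obtain ⟨b1, b2, -⟩ := blockSum_flatSeq hl (le_max_left w.length p.parts.card)
      rw [← isFlat_part_iff, a1, a2, e, b1, b2]
      exact ⟨hflat, hs, ht⟩
  · rintro ⟨w, ms⟩ h ⟨w', ms'⟩ h' e
    obtain ⟨rfl, rfl⟩ := flatSeq_injective h.1 h'.1 e
    rfl

theorem numLengthType_eq_ncard (s t n : ℕ) :
    numLengthType s t n = (codes gapSize s t n).ncard := by
  have hinj : Function.Injective fun p : n.Partition => p.parts := fun p q h => by
    ext1; exact h
  rw [numLengthType, ← Set.ncard_coe_finset, ← Set.ncard_image_of_injective _ hinj,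
    ← Set.InjOn.ncard_image (s := codes gapSize s t n)
      (f := fun c => (gapParts 1 c.1 c.2 : Multiset ℕ))]
  · congr 1
    ext m
    constructor
    · rintro ⟨p, hp, rfl⟩
      simp only [Finset.coe_filter, Set.mem_ofPred_eq, Nat.Partition.restricted, Finset.mem_filter,
        Finset.mem_univ, true_and] at hp
      obtain ⟨hp, rfl, rfl⟩ := hp
      obtain ⟨w, gs, hl, e⟩ := exists_gapParts_eq (p := 1) (by simp)
        (l := p.parts.sort (· ≤ ·))
        (fun a ha => by
          rw [Multiset.mem_sort] at ha
          have := p.parts_pos ha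
          have := hp a ha
          omega) (Multiset.pairwise_sort _ _)
      have e' : (gapParts 1 w gs : Multiset ℕ) = p.parts := by rw [e, Multiset.sort_eq]
      obtain ⟨c1, c2⟩ := countP_gapParts (p := 1) hl
      have hsum := sum_gapParts (p := 1) (by simp) hl
      rw [← Multiset.sum_coe, e', p.parts_sum] at hsum
      rw [← Multiset.coe_countP, e'] at c1 c2
      -- Gaps are counted from 1, which has quotient 0 and cannot begin a descent, so the initial
      -- terms of `sum_gapParts` vanish.
      have hk : brk false w = true → w = [] := by cases w <;> simp [brk]
      refine ⟨(w, gs), ⟨hl, c1.symm, c2.symm, ?_⟩, e'⟩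
      unfold lengthType
      rw [c1, c2, hsum]
      simp
      exact hk
    · rintro ⟨⟨w, gs⟩, ⟨hl, hs, ht, hn⟩, rfl⟩
      simp only at hl hs ht hn ⊢
      obtain ⟨c1, c2⟩ := countP_gapParts (p := 1) hl
      have hsum := sum_gapParts (p := 1) (by simp) hl
      have hk : brk false w = true → w = [] := by cases w <;> simp [brk]
      have hmem := (le_of_mem_gapParts (p := 1) (by simp) (w := w) (gs := gs)).1
      refine ⟨⟨gapParts 1 w gs, fun {i} hi => (hmem i hi).1, ?_⟩, ?_, rfl⟩
      · rw [Multiset.sum_coe, hsum, ← hn, hs, ht]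
        simp
        exact hk
      · simp only [Finset.coe_filter, Set.mem_ofPred_eq, Nat.Partition.restricted,
          Finset.mem_filter, Finset.mem_univ, true_and, lengthType, Multiset.coe_countP]
        refine ⟨fun a ha => ?_, c1.trans hs, c2.trans ht⟩
        have := (hmem a ha).2
        omega
  · rintro ⟨w, gs⟩ h ⟨w', gs'⟩ h' e
    have hp := List.Perm.eq_of_pairwise' (r := fun a b : ℕ => a ≤ b)
      (le_of_mem_gapParts (by simp)).2 (le_of_mem_gapParts (by simp)).2 (Multiset.coe_eq_coe.1 e)
    obtain ⟨rfl, rfl⟩ := gapParts_injective h.1 h'.1 hp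
    rfl

/-- The alternating sum type of partitions with parts repeated at most twice is distributed as the
length type of partitions without multiples of `3`. -/
theorem numAltSumType_eq_numLengthType (s t n : ℕ) :
    numAltSumType s t n = numLengthType s t n := by
  rw [numAltSumType_eq_ncard, numLengthType_eq_ncard, ncard_codes]

end PartitionType

theorem theorem3p1 (S n : ℕ) :
    PartitionType.numAltSumType S 2 n = PartitionType.numLengthType S 2 n ∧
    PartitionType.numAltSumType 2 S n = PartitionType.numLengthType 2 S n := by
  exact ⟨PartitionType.numAltSumType_eq_numLengthType S 2 n,
    PartitionType.numAltSumType_eq_numLengthType 2 S n⟩
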